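/- Let $C$ be a finite set of colours and let $G=(V,E)$ be a graph with a colouring $\omega:V\to C$ (not necessarily proper). A move $(v,d)$, with $v\in V$ and $d\in C$, gives colour $d$ to all vertices in the same monochromatic component as $v$. FREE-FLOOD-IT asks for the minimum number $m(G,\omega)$ of moves after which all vertices of $G$ have the same colour; $c$-FREE-FLOOD-IT is the same problem with a colour-set of fixed size $c$. Two vertices are *linked* if they lie in one monochromatic component. The model of computation is a random access machine with operations $+$, truncated $-$, $\times$, indirect addressing and tests for zero, each at unit cost. A path $P$ with $|P|=n\ge 1$ vertices (equivalently a $1\times n$ board), coloured with colours $0,\dots,c-1$, is given by $n$, $c$ and the list of the colours of its vertices in order, and all words occurring in a computation have $O(\log(n+c))$ bits. 1. There is a program that, given any coloured path $P$, with any number of colours, computes $m(P,\omega)$ in time $O(|P|^6)$, where the implied constant does not depend on $P$, on $\omega$ or on the number of colours. 2. For every fixed $c$ there is a program that, given any path $P$ coloured from a set of $c$ colours, computes $m(P,\omega)$ in time $O(|P|^4)$, where the implied constant depends only on $c$. 3. Flooding a path is the same as linking its end-vertices: if $u$ and $v$ are the end-vertices of a path $P$ with colouring $\omega$, then a sequence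 of moves makes $P$ monochromatic if and only if it links $u$ and $v$ (that is, $u$ and $v$ are linked in the resulting colouring), and $m(P,\omega)$ equals the minimum number of moves that link $u$ and $v$. -/

import Mathlib

/-! ## The flooding game on a coloured graph -/

namespace FloodIt

/-- Two vertices are adjacent in `monoGraph G ω` if they are adjacent in `G` and have the same colour
under `ω`; its connected components are the monochromatic components of `G`. -/
def monoGraph {V C : Type} (G : SimpleGraph V) (ω : V → C) : SimpleGraph V where
  Adj x y := G.Adj x y ∧ ω x = ω y
  symm := ⟨fun _ _ h => ⟨h.1.symm, h.2.symm⟩⟩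
  loopless := ⟨fun _ h => G.irrefl h.1⟩

/-- `x` and `y` are linked: they lie in one monochromatic component. -/
def Linked {V C : Type} (G : SimpleGraph V) (ω : V → C) (x y : V) : Prop :=
  (monoGraph G ω).Reachable x y

open Classical in
/-- The move `m = (v, d)` gives colour `d` to the whole monochromatic component of `v`. -/
noncomputable def move {V C : Type} (G : SimpleGraph V) (ω : V → C) (m : V × C) : V → C :=
  fun w => if Linked G ω m.1 w then m.2 else ω w

/-- The colouring obtained from `ω` by playing a sequence of moves, first move first. -/
noncomputable def play {V C : Type} (G : SimpleGraph V) (ω : V → C) (S : List (V × C)) : V → C :=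
  S.foldl (move G) ω

/-- All vertices have the same colour. -/
def Monochromatic {V C : Type} (ω : V → C) : Prop := ∃ d : C, ∀ v, ω v = d

/-- `r` is the minimum number of moves that make `G` monochromatic (so the minimum is attained). -/
def IsFloodNumber {V C : Type} (G : SimpleGraph V) (ω : V → C) (r : ℕ) : Prop :=
  IsLeast {k | ∃ S : List (V × C), S.length = k ∧ Monochromatic (play G ω S)} r

/-- `r` is the minimum number of moves that link `u` and `v` in `G` (so the minimum is attained). -/
def IsLinkNumber {V C : Type} (G : SimpleGraph V) (ω : V → C) (u v : V) (r : ℕ) : Prop :=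
  IsLeast {k | ∃ S : List (V × C), S.length = k ∧ Linked G (play G ω S) u v} r

end FloodIt

/-! ## A random access machine with words of bounded size

Programs are structured (sequencing, conditionals, `while` loops) and act on one memory of natural
numbers with indirect addressing. Every constant, memory access, arithmetic operation, assignment
and test costs one step. Execution takes a parameter `W`: every word that is ever computed, be it a
value or an address, has to be smaller than `W`; a program that would leave this range is stuck. -/

namespace RAM

/-- A memory: one number for each address. -/
abbrev Mem : Type := ℕ → ℕ

/-- Arithmetic expressions; `load a` is the content of the cell whose address is the value of `a`. -/
inductive Expr : Type
  | const (k : ℕ) : Expr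
  | load (a : Expr) : Expr
  | add (a b : Expr) : Expr
  | sub (a b : Expr) : Expr
  | mul (a b : Expr) : Expr

/-- The value of an expression; subtraction is truncated at `0`. -/
def Expr.val (m : Mem) : Expr → ℕ
  | .const k => k
  | .load a => m (a.val m)
  | .add a b => a.val m + b.val m
  | .sub a b => a.val m - b.val m
  | .mul a b => a.val m * b.val m

/-- Evaluating the expression in the memory `m` only produces words smaller than `W`. -/
def Expr.Fits (W : ℕ) (m : Mem) : Expr → Prop
  | .const k => k < W
  | .load a => a.Fits W m ∧ m (a.val m) < W
  | .add a b => a.Fits W m ∧ b.Fits W m ∧ a.val m + b.val m < W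
  | .sub a b => a.Fits W m ∧ b.Fits W m
  | .mul a b => a.Fits W m ∧ b.Fits W m ∧ a.val m * b.val m < W

/-- The number of steps needed to evaluate an expression. -/
def Expr.cost : Expr → ℕ
  | .const _ => 1
  | .load a => a.cost + 1
  | .add a b => a.cost + b.cost + 1
  | .sub a b => a.cost + b.cost + 1
  | .mul a b => a.cost + b.cost + 1

/-- Programs. `store a e` writes the value of `e` into the cell whose address is the value of `a`;
tests in `ite` and `loop` succeed if the value is nonzero. -/
inductive Prog : Type
  | skip : Prog
  | store (a e : Expr) : Prog
  | seq (p q : Prog) : Prog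
  | ite (b : Expr) (p q : Prog) : Prog
  | loop (b : Expr) (p : Prog) : Prog

/-- `Exec W p m m' t`: with all words smaller than `W`, the program `p` started in memory `m` halts
in memory `m'` after exactly `t` steps. -/
inductive Exec (W : ℕ) : Prog → Mem → Mem → ℕ → Prop
  | skip (m : Mem) : Exec W .skip m m 1
  | store (a e : Expr) (m : Mem) : a.Fits W m → e.Fits W m →
      Exec W (.store a e) m (Function.update m (a.val m) (e.val m)) (a.cost + e.cost + 1)
  | seq {p q : Prog} {m₁ m₂ m₃ : Mem} {s t : ℕ} : Exec W p m₁ m₂ s → Exec W q m₂ m₃ t →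
      Exec W (.seq p q) m₁ m₃ (s + t)
  | iteTrue {b : Expr} {p q : Prog} {m m' : Mem} {t : ℕ} : b.Fits W m → b.val m ≠ 0 →
      Exec W p m m' t → Exec W (.ite b p q) m m' (b.cost + 1 + t)
  | iteFalse {b : Expr} {p q : Prog} {m m' : Mem} {t : ℕ} : b.Fits W m → b.val m = 0 →
      Exec W q m m' t → Exec W (.ite b p q) m m' (b.cost + 1 + t)
  | loopDone {b : Expr} {p : Prog} {m : Mem} : b.Fits W m → b.val m = 0 →
      Exec W (.loop b p) m m (b.cost + 1)
  | loopStep {b : Expr} {p : Prog} {m₁ m₂ m₃ : Mem} {s t : ℕ} : b.Fits W m₁ → b.val m₁ ≠ 0 →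
      Exec W p m₁ m₂ s → Exec W (.loop b p) m₂ m₃ t →
      Exec W (.loop b p) m₁ m₃ (b.cost + 1 + s + t)

end RAM

/-! ## Solving the game on paths -/

namespace FloodIt

/-- The input memory for a path on `n` vertices coloured from a set of `c` colours: cell `0` holds
`n`, cell `1` holds `c`, cell `i + 2` holds the colour of the `i`-th vertex (for `i < n`), and all
other cells hold `0`. -/
def inputMem {n c : ℕ} (ω : Fin n → Fin c) : RAM.Mem
  | 0 => n
  | 1 => c
  | i + 2 => if h : i < n then (ω ⟨i, h⟩ : ℕ) else 0

/-- Started on the path on `n` vertices with colouring `ω`, and with all words smaller than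
`(n + c + 2) ^ k` (that is, of `O(log (n + c))` bits), the program `p` halts after at most `T` steps
with the minimum number of moves that flood the path in cell `0`. -/
def SolvesPathWithin (p : RAM.Prog) (k T : ℕ) {n c : ℕ} (ω : Fin n → Fin c) : Prop :=
  ∃ (m : RAM.Mem) (t : ℕ), RAM.Exec ((n + c + 2) ^ k) p (inputMem ω) m t ∧ t ≤ T ∧
    IsFloodNumber (SimpleGraph.pathGraph n) ω (m 0)

end FloodIt

/-! ### Noncrossing partitions and the interval recurrence. -/

namespace FloodIt

/-! The flood number of a nonempty path is one less than the least number of blocks in a noncrossing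
partition of its vertices into single-coloured blocks (`isFloodNumber_pathGraph`).

Lower bound: a move lowers `minBlocks` by at most one, because a partition for the new colouring
becomes one for the old colouring once the recoloured component is cut out as a block of its own
(`minBlocks_le_move`); a monochromatic path has `minBlocks` at most one. Upper bound: some innermost
block is an interval, and one move at most merges it with a neighbouring block
(`NonCrossing.exists_convex`, `NonCrossing.merge`, `NonCrossing.exists_play`).

Looking at the next vertex `j` in the block of `l`, if any, gives the recurrence: `minBlocks a l r`
is the minimum of `minBlocks a (l + 1) r + 1` and all `minBlocks a (l + 1) j + minBlocks a j r` with
`l < j < r` and `a j = a l`. Dynamic programming over intervals thus takes cubic time for any number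
of colours, so that one program serves both time bounds. The statement on end-vertices holds because
being linked on a path means that the whole interval in between has one colour. -/

/-- The fibres of `g` partition the interval `[l, r)` into pairwise noncrossing blocks on each of
which the colouring `a` is constant. -/
structure NonCrossing (a g : ℕ → ℕ) (l r : ℕ) : Prop where
  color : ∀ i j, l ≤ i → i < r → l ≤ j → j < r → g i = g j → a i = a j
  cross : ∀ i j k m, l ≤ i → i < j → j < k → k < m → m < r → g i = g k → g j = g m → g i = g j

/-- The number of blocks of the partition of `[l, r)` into fibres of `g`. -/
def blocks (g : ℕ → ℕ) (l r : ℕ) : ℕ := ((Finset.Ico l r).image g).card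

/-- The least number of blocks of a noncrossing partition of `[l, r)` into monochromatic blocks. -/
noncomputable def minBlocks (a : ℕ → ℕ) (l r : ℕ) : ℕ :=
  sInf {b | ∃ g, NonCrossing a g l r ∧ blocks g l r = b}

theorem NonCrossing.mono {a g : ℕ → ℕ} {l r l' r' : ℕ} (h : NonCrossing a g l r) (hl : l ≤ l')
    (hr : r' ≤ r) : NonCrossing a g l' r' where
  color i j h1 h2 h3 h4 := h.color i j (by omega) (by omega) (by omega) (by omega)
  cross i j k m h1 h2 h3 h4 h5 := h.cross i j k m (by omega) h2 h3 h4 (by omega)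

theorem NonCrossing.minBlocks_le {a g : ℕ → ℕ} {l r : ℕ} (h : NonCrossing a g l r) :
    minBlocks a l r ≤ blocks g l r :=
  Nat.sInf_le ⟨g, h, rfl⟩

/-- The partition into singletons shows that the `sInf` is over a nonempty set, hence attained. -/
theorem exists_blocks_eq_minBlocks (a : ℕ → ℕ) (l r : ℕ) :
    ∃ g, NonCrossing a g l r ∧ blocks g l r = minBlocks a l r := by
  have hne : {b | ∃ g, NonCrossing a g l r ∧ blocks g l r = b}.Nonempty := by
    refine ⟨_, id, ⟨?_, ?_⟩, rfl⟩
    · rintro i j - - - - h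
      exact congrArg a h
    · intro i j k m _ _ _ _ _ h
      simp only [id] at h
      omega
  exact Nat.sInf_mem hne

theorem minBlocks_le_sub (a : ℕ → ℕ) (l r : ℕ) : minBlocks a l r ≤ r - l := by
  obtain ⟨g, -, hb⟩ := exists_blocks_eq_minBlocks a l r
  rw [← hb]
  exact Finset.card_image_le.trans (by simp)

theorem minBlocks_self (a : ℕ → ℕ) (l : ℕ) : minBlocks a l l = 0 := by
  have := minBlocks_le_sub a l l
  omega

/-- Adding `l` as a singleton crosses nothing; shifting the old labels by one frees the label `0`
for it. -/
theorem minBlocks_le_succ (a : ℕ → ℕ) (l r : ℕ) :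
    minBlocks a l r ≤ minBlocks a (l + 1) r + 1 := by
  obtain ⟨g, hg, hb⟩ := exists_blocks_eq_minBlocks a (l + 1) r
  have h : NonCrossing a (fun i => if i = l then 0 else g i + 1) l r := by
    constructor
    · intro i j h1 h2 h3 h4 h
      by_cases hi : i = l <;> by_cases hj : j = l <;> simp [hi, hj] at h ⊢
      exact hg.color i j (by omega) h2 (by omega) h4 h
    · intro i j k m h1 h2 h3 h4 h5 h6 h7
      have hj : j ≠ l := by omega
      have hk : k ≠ l := by omega
      have hm : m ≠ l := by omega
      by_cases hi : i = l <;> simp [hi, hj, hk, hm] at h6 h7 ⊢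
      exact hg.cross i j k m (by omega) h2 h3 h4 h5 h6 h7
  refine h.minBlocks_le.trans ?_
  rw [← hb, blocks, blocks]
  have hsub : (Finset.Ico l r).image (fun i => if i = l then 0 else g i + 1) ⊆
      insert 0 (((Finset.Ico (l + 1) r).image g).image (· + 1)) := by
    intro x hx
    simp only [Finset.mem_image, Finset.mem_Ico, Finset.mem_insert] at hx ⊢
    obtain ⟨i, hi, rfl⟩ := hx
    by_cases hil : i = l
    · simp [hil]
    · exact Or.inr ⟨g i, ⟨i, by omega, rfl⟩, by simp [hil]⟩
  exact (Finset.card_le_card hsub).trans ((Finset.card_insert_le _ _).trans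
    (Nat.succ_le_succ Finset.card_image_le))

/-- Here `l` joins the block of `j`. Odd labels inside `(l, j)` and even labels elsewhere keep the
two partitions apart, and the odd blocks cross nothing since they sit between `l` and `j`. -/
theorem minBlocks_le_add (a : ℕ → ℕ) {l j r : ℕ} (hlj : l < j) (hjr : j < r) (ha : a j = a l) :
    minBlocks a l r ≤ minBlocks a (l + 1) j + minBlocks a j r := by
  obtain ⟨g₁, hg₁, hb₁⟩ := exists_blocks_eq_minBlocks a (l + 1) j
  obtain ⟨g₂, hg₂, hb₂⟩ := exists_blocks_eq_minBlocks a j r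
  let g : ℕ → ℕ := fun i => if i = l then 2 * g₂ j else if i < j then 2 * g₁ i + 1 else 2 * g₂ i
  have hgl : g l = 2 * g₂ j := by simp [g]
  have hg1 : ∀ i, l < i → i < j → g i = 2 * g₁ i + 1 := by
    intro i h1 h2
    simp [g, h2, h1.ne']
  have hg2 : ∀ i, j ≤ i → g i = 2 * g₂ i := by
    intro i h
    have h1 : i ≠ l := by omega
    have h2 : ¬ i < j := by omega
    simp [g, h1, h2]
  have hpos : ∀ i, l ≤ i → i = l ∨ (l < i ∧ i < j) ∨ j ≤ i := by omega
  have h : NonCrossing a g l r := by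
    constructor
    · intro i k h1 h2 h3 h4 h
      rcases hpos i h1 with rfl | hi | hi <;> rcases hpos k h3 with hk | hk | hk
      · rw [hk]
      · rw [hgl, hg1 k hk.1 hk.2] at h; omega
      · rw [hgl, hg2 k hk] at h
        rw [← ha]
        exact hg₂.color j k le_rfl hjr hk h4 (by omega)
      · rw [hk, hgl, hg1 i hi.1 hi.2] at h; omega
      · rw [hg1 k hk.1 hk.2, hg1 i hi.1 hi.2] at h
        exact hg₁.color i k hi.1 hi.2 hk.1 hk.2 (by omega)
      · rw [hg2 k hk, hg1 i hi.1 hi.2] at h; omega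
      · rw [hk, hgl, hg2 i hi] at h
        rw [hk, ← ha]
        exact hg₂.color i j hi h2 le_rfl hjr (by omega)
      · rw [hg1 k hk.1 hk.2, hg2 i hi] at h; omega
      · rw [hg2 k hk, hg2 i hi] at h
        exact hg₂.color i k hi h2 hk h4 (by omega)
    · intro i x k m h1 h2 h3 h4 h5 h6 h7
      rcases hpos x (by omega) with hx | hx | hx
      · omega
      · rw [hg1 x hx.1 hx.2] at h7 ⊢
        have hm : m < j := by
          by_contra hm
          rw [hg2 m (by omega)] at h7
          omega
        rw [hg1 m (by omega) hm] at h7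
        rw [hg1 k (by omega) (by omega)] at h6
        rcases hpos i h1 with hi | hi | hi
        · rw [hi, hgl] at h6; omega
        · rw [hg1 i hi.1 hi.2] at h6 ⊢
          rw [hg₁.cross i x k m hi.1 h2 h3 h4 hm (by omega) (by omega)]
        · omega
      · rw [hg2 x hx] at h7 ⊢
        rw [hg2 m (by omega)] at h7
        rw [hg2 k (by omega)] at h6
        rcases hpos i h1 with hi | hi | hi
        · rw [hi, hgl] at h6 ⊢
          rcases hx.eq_or_lt with rfl | hx
          · rfl
          · rw [hg₂.cross j x k m le_rfl hx h3 h4 h5 (by omega) (by omega)]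
        · rw [hg1 i hi.1 hi.2] at h6; omega
        · rw [hg2 i hi] at h6 ⊢
          rw [hg₂.cross i x k m hi h2 h3 h4 h5 (by omega) (by omega)]
  refine h.minBlocks_le.trans ?_
  rw [← hb₁, ← hb₂, blocks, blocks, blocks]
  have hsub : (Finset.Ico l r).image g ⊆
      ((Finset.Ico (l + 1) j).image g₁).image (2 * · + 1) ∪
        ((Finset.Ico j r).image g₂).image (2 * ·) := by
    intro x hx
    simp only [Finset.mem_image, Finset.mem_Ico, Finset.mem_union] at hx ⊢
    obtain ⟨i, hi, rfl⟩ := hx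
    rcases hpos i hi.1 with rfl | hi' | hi'
    · exact Or.inr ⟨g₂ j, ⟨j, by omega, rfl⟩, hgl.symm⟩
    · exact Or.inl ⟨g₁ i, ⟨i, by omega, rfl⟩, (hg1 i hi'.1 hi'.2).symm⟩
    · exact Or.inr ⟨g₂ i, ⟨i, by omega, rfl⟩, (hg2 i hi').symm⟩
  exact (Finset.card_le_card hsub).trans ((Finset.card_union_le _ _).trans
    (Nat.add_le_add Finset.card_image_le Finset.card_image_le))

/-- If `l` is a singleton of an optimal partition, delete it. Otherwise let `j` be the next element
of its block: a block meeting both `(l, j)` and `[j, r)` would cross that block or contradict the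
choice of `j`, so the two sides share no label. -/
theorem le_minBlocks (a : ℕ → ℕ) {l r : ℕ} (hlr : l < r) :
    minBlocks a (l + 1) r + 1 ≤ minBlocks a l r ∨ ∃ j, l < j ∧ j < r ∧ a j = a l ∧
      minBlocks a (l + 1) j + minBlocks a j r ≤ minBlocks a l r := by
  classical
  obtain ⟨g, hg, hb⟩ := exists_blocks_eq_minBlocks a l r
  rw [← hb]
  by_cases hex : ∃ j, l < j ∧ j < r ∧ g j = g l
  · right
    obtain ⟨hlj, hjr, hgj⟩ := Nat.find_spec hex
    have hmin : ∀ x, l < x → x < Nat.find hex → g x ≠ g l := fun x h1 h2 h3 =>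
      Nat.find_min hex h2 ⟨h1, h2.trans hjr, h3⟩
    generalize Nat.find hex = j at *
    refine ⟨j, hlj, hjr, hg.color j l hlj.le hjr le_rfl hlr hgj, ?_⟩
    refine (Nat.add_le_add (hg.mono (Nat.le_succ l) hjr.le).minBlocks_le
      (hg.mono hlj.le le_rfl).minBlocks_le).trans ?_
    rw [blocks, blocks, blocks, ← Finset.card_union_of_disjoint]
    · refine Finset.card_le_card (Finset.union_subset ?_ ?_) <;>
        exact Finset.image_subset_image (Finset.Ico_subset_Ico (by omega) (by omega))
    · rw [Finset.disjoint_left]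
      intro y hy hy'
      simp only [Finset.mem_image, Finset.mem_Ico] at hy hy'
      obtain ⟨x, hx, rfl⟩ := hy
      obtain ⟨z, hz, hzx⟩ := hy'
      rcases hz.1.eq_or_lt with rfl | hjz
      · exact hmin x hx.1 hx.2 (hzx.symm.trans hgj)
      · exact hmin x hx.1 hx.2
          (hg.cross l x j z le_rfl hx.1 hx.2 hjz hz.2 hgj.symm hzx.symm).symm
  · left
    refine (Nat.add_le_add_right (hg.mono (Nat.le_succ l) le_rfl).minBlocks_le 1).trans ?_
    have hnot : g l ∉ (Finset.Ico (l + 1) r).image g := by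
      simp only [Finset.mem_image, Finset.mem_Ico]
      rintro ⟨j, hj, hgj⟩
      exact hex ⟨j, by omega, hj.2, hgj⟩
    rw [blocks, blocks, ← Finset.card_insert_of_notMem hnot, ← Finset.image_insert,
      Finset.insert_Ico_add_one_left_eq_Ico hlr]

/-! ### Innermost blocks and how they merge. -/

/-- A discrete intermediate value argument that locates the border of a block; the border may lie on
either side, hence the two orientations. -/
theorem exists_adjacent_change (P : ℕ → Prop) {x y : ℕ} (hx : P x) (hy : ¬ P y) :
    ∃ u u', (u' = u + 1 ∨ u = u' + 1) ∧ P u ∧ ¬ P u' ∧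
      min x y ≤ u ∧ u ≤ max x y ∧ min x y ≤ u' ∧ u' ≤ max x y := by
  induction hs : (y - x) + (x - y) generalizing x with
  | zero =>
    obtain rfl : x = y := by omega
    exact absurd hx hy
  | succ s ih =>
    rcases lt_or_ge x y with h | h
    · by_cases hP : P (x + 1)
      · obtain ⟨u, u', h1, h2, h3, h4⟩ := ih hP (by omega)
        exact ⟨u, u', h1, h2, h3, by omega⟩
      · exact ⟨x, x + 1, Or.inl rfl, hx, hP, by omega⟩
    · obtain ⟨w, rfl⟩ : ∃ w, x = w + 1 := ⟨x - 1, by omega⟩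
      by_cases hP : P w
      · obtain ⟨u, u', h1, h2, h3, h4⟩ := ih hP (by omega)
        exact ⟨u, u', h1, h2, h3, by omega⟩
      · exact ⟨w + 1, w, Or.inr rfl, hx, hP, by omega⟩

/-- An innermost block of a noncrossing partition is an interval. -/
theorem NonCrossing.exists_convex {a g : ℕ → ℕ} {n : ℕ} (hg : NonCrossing a g 0 n) (hn : 0 < n) :
    ∃ z < n, ∀ i j k, i < j → j < k → k < n → g i = g z → g k = g z → g j = g z := by
  by_contra! hcon
  -- Descent on the length of a gap: if no block is an interval, the block of a vertex `j` inside a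
  -- gap has a gap of its own, and noncrossing confines it strictly between `i` and `k`.
  have key : ∀ s i j k, k - i ≤ s → i < j → j < k → k < n → g i = g k → g j ≠ g i → False := by
    intro s
    induction s with
    | zero => intro i j k; omega
    | succ s ih =>
      intro i j k hs hij hjk hk hgk hgj
      obtain ⟨i', j', k', h1, h2, h3, h4, h5, h6⟩ := hcon j (by omega)
      have hi : i < i' := by
        by_contra hi
        rcases (not_lt.1 hi).eq_or_lt with rfl | hi
        · exact hgj h4.symm
        · exact hgj (h4.symm.trans (hg.cross i' i j k (Nat.zero_le _) hi hij hjk hk h4 hgk))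
      have hk' : k' < k := by
        by_contra hk'
        rcases (not_lt.1 hk').eq_or_lt with rfl | hk'
        · exact hgj (h5.symm.trans hgk.symm)
        · exact hgj (hg.cross i j k k' (Nat.zero_le _) hij hjk hk' h3 hgk h5.symm).symm
      exact ih i' j' k' (by omega) h1 h2 h3 (h4.trans h5.symm) (fun h => h6 (h.trans h4))
  obtain ⟨i, j, k, h1, h2, h3, h4, h5, h6⟩ := hcon 0 hn
  exact key _ i j k le_rfl h1 h2 h3 (h4.trans h5.symm) (fun h => h6 (h.trans h4))

/-- Merging an interval block with the block of a vertex next to it. -/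
theorem NonCrossing.merge {a a' g : ℕ → ℕ} {n z u u' : ℕ} (hg : NonCrossing a g 0 n) (hz : z < n)
    (hconv : ∀ i j k, i < j → j < k → k < n → g i = g z → g k = g z → g j = g z)
    (hadj : u' = u + 1 ∨ u = u' + 1) (hu : u < n) (hu' : u' < n) (hgu : g u = g z)
    (hgu' : g u' ≠ g z) (ha : ∀ i < n, a' i = if g i = g z then a u' else a i) :
    ∃ g', NonCrossing a' g' 0 n ∧ blocks g' 0 n < blocks g 0 n := by
  -- Seen from a vertex outside the block other than `u'`, the vertex `u'` lies on the same side as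
  -- the block.
  have hlt : ∀ i < n, g i = g z → ∀ j < n, g j ≠ g z → j ≠ u' → (i < j → u' < j) ∧
      (j < i → j < u') := by
    intro i hi hgi j hj hgj hju
    have hne : u ≠ j := fun h => hgj (h ▸ hgu)
    refine ⟨fun hij => ?_, fun hji => ?_⟩
    · by_contra hc
      exact hgj (hconv i j u hij (by omega) hu hgi hgu)
    · by_contra hc
      exact hgj (hconv u j i (by omega) hji hi hgu hgi)
  have hne : ∀ i j, g j ≠ g i → j ≠ i := fun i j h h' => h (h' ▸ rfl)
  -- Collapsing the block onto `u'` keeps the order of vertices with different new labels, so the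
  -- pullback of `g` along `f` is again noncrossing.
  let f : ℕ → ℕ := fun i => if g i = g z then u' else i
  have hf1 : ∀ i, g i = g z → f i = u' := fun i h => if_pos h
  have hf2 : ∀ i, g i ≠ g z → f i = i := fun i h => if_neg h
  have hfn : ∀ i < n, f i < n := by
    intro i hi
    by_cases h : g i = g z
    · rwa [hf1 i h]
    · rwa [hf2 i h]
  have hfz : ∀ i, g (f i) ≠ g z := by
    intro i
    by_cases h : g i = g z
    · rwa [hf1 i h]
    · rwa [hf2 i h]
  have hmono : ∀ i j, i < j → j < n → g (f i) ≠ g (f j) → f i < f j := by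
    intro i j hij hj hgf
    by_cases hi : g i = g z <;> by_cases hj' : g j = g z
    · rw [hf1 i hi, hf1 j hj'] at hgf; exact absurd rfl hgf
    · rw [hf1 i hi, hf2 j hj'] at hgf ⊢
      exact (hlt i (by omega) hi j hj hj' (hne _ _ hgf.symm)).1 hij
    · rw [hf2 i hi, hf1 j hj'] at hgf ⊢
      exact (hlt j hj hj' i (by omega) hi (hne _ _ hgf)).2 hij
    · rwa [hf2 i hi, hf2 j hj']
  refine ⟨fun i => g (f i), ⟨?_, ?_⟩, ?_⟩
  · have haf : ∀ i < n, a' i = a (f i) := by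
      intro i hi
      rw [ha i hi]
      by_cases h : g i = g z
      · rw [hf1 i h, if_pos h]
      · rw [hf2 i h, if_neg h]
    intro i j _ hi _ hj h
    rw [haf i hi, haf j hj]
    exact hg.color _ _ (Nat.zero_le _) (hfn i hi) (Nat.zero_le _) (hfn j hj) h
  · intro i j k m _ hij hjk hkm hm h1 h2
    by_contra hc
    exact hc (hg.cross (f i) (f j) (f k) (f m) (Nat.zero_le _)
      (hmono i j hij (by omega) hc) (hmono j k hjk (by omega) fun h => hc (h1.trans h.symm))
      (hmono k m hkm hm fun h => hc (h1.trans (h.trans h2.symm))) (hfn m hm) h1 h2)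
  -- The label `g z` is no longer used.
  · refine Finset.card_lt_card (Finset.ssubset_iff_of_subset ?_ |>.2 ⟨g z, ?_, ?_⟩)
    · intro x hx
      simp only [Finset.mem_image, Finset.mem_Ico] at hx ⊢
      obtain ⟨i, hi, rfl⟩ := hx
      exact ⟨f i, ⟨Nat.zero_le _, hfn i hi.2⟩, rfl⟩
    · exact Finset.mem_image_of_mem g (by simpa using hz)
    · simp only [Finset.mem_image, not_exists, not_and]
      exact fun i _ => hfz i

/-! ### The flood number in terms of `minBlocks`. -/

/-- The colour of the `i`-th vertex, as a function on all natural numbers. -/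
def colorAt {n c : ℕ} (ω : Fin n → Fin c) (i : ℕ) : ℕ := if h : i < n then (ω ⟨i, h⟩ : ℕ) else 0

theorem colorAt_of_lt {n c : ℕ} (ω : Fin n → Fin c) {i : ℕ} (h : i < n) :
    colorAt ω i = ω ⟨i, h⟩ := dif_pos h

/-- Any walk from `x` to `y` visits all vertices between them; conversely, induct on the distance,
written as a sum of two truncated differences. -/
theorem linked_pathGraph_iff {n : ℕ} {C : Type} (ω : Fin n → C) (x y : Fin n) :
    Linked (SimpleGraph.pathGraph n) ω x y ↔
      ∀ z, (x ≤ z ∧ z ≤ y) ∨ (y ≤ z ∧ z ≤ x) → ω z = ω x := by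
  constructor
  · intro h
    rw [Linked, SimpleGraph.reachable_iff_reflTransGen] at h
    induction h with
    | refl =>
      intro z hz
      rw [show z = x by omega]
    | @tail y y' _ hadj ih =>
      intro z hz
      obtain ⟨h1, h2⟩ := hadj
      rw [SimpleGraph.pathGraph_adj] at h1
      by_cases hzy : z = y'
      · rw [hzy, ← h2]
        exact ih y (by omega)
      · exact ih z (by omega)
  · induction hs : ((y : ℕ) - x) + ((x : ℕ) - y) generalizing y with
    | zero =>
      intro _
      obtain rfl : x = y := by omega
      exact SimpleGraph.Reachable.refl _
    | succ s ih =>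
      intro h
      have step : ∀ y' : Fin n, (y : ℕ) = y' + 1 ∨ (y' : ℕ) = y + 1 →
          ((y' : ℕ) - x) + ((x : ℕ) - y') = s → Linked (SimpleGraph.pathGraph n) ω x y := by
        intro y' hadj hy'
        refine (ih y' hy' fun z hz => h z (by omega)).trans (SimpleGraph.Adj.reachable ⟨?_, ?_⟩)
        · rw [SimpleGraph.pathGraph_adj]; omega
        · rw [h y (by omega), h y' (by omega)]
      rcases lt_or_ge x y with hxy | hxy
      · exact step ⟨y - 1, by omega⟩ (Or.inl (by simp only; omega)) (by simp only; omega)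
      · exact step ⟨y + 1, by omega⟩ (Or.inr rfl) (by simp only; omega)

theorem monochromatic_iff_linked {n : ℕ} {C : Type} (ω : Fin (n + 1) → C) :
    Monochromatic ω ↔ Linked (SimpleGraph.pathGraph (n + 1)) ω 0 (Fin.last n) := by
  rw [linked_pathGraph_iff]
  exact ⟨fun ⟨d, hd⟩ z _ => (hd z).trans (hd 0).symm,
    fun h => ⟨ω 0, fun v => h v (Or.inl ⟨Fin.zero_le v, Fin.le_last v⟩)⟩⟩

/-- Outside the recoloured component `I` the two colourings agree, and `I` is a monochromatic
interval, so making it a separate block (label `0`) causes no crossing and costs one block. -/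
theorem minBlocks_le_move {n c : ℕ} (ω : Fin n → Fin c) (m : Fin n × Fin c) :
    minBlocks (colorAt ω) 0 n ≤
      minBlocks (colorAt (move (SimpleGraph.pathGraph n) ω m)) 0 n + 1 := by
  classical
  obtain ⟨g, hg, hb⟩ := exists_blocks_eq_minBlocks
    (colorAt (move (SimpleGraph.pathGraph n) ω m)) 0 n
  let I : ℕ → Prop := fun i => ∃ h : i < n, Linked (SimpleGraph.pathGraph n) ω m.1 ⟨i, h⟩
  have hIcolor : ∀ i, I i → colorAt ω i = ω m.1 := by
    rintro i ⟨hi, h⟩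
    rw [linked_pathGraph_iff] at h
    rw [colorAt_of_lt ω hi, h ⟨i, hi⟩ (by omega)]
  have hIconv : ∀ i j k, i < j → j < k → I i → I k → I j := by
    rintro i j k hij hjk ⟨hi, h1⟩ ⟨hk, h2⟩
    refine ⟨hjk.trans hk, ?_⟩
    rw [linked_pathGraph_iff] at h1 h2 ⊢
    intro z hz
    by_cases hzi : (m.1 ≤ z ∧ z ≤ ⟨i, hi⟩) ∨ (⟨i, hi⟩ ≤ z ∧ z ≤ m.1)
    · exact h1 z hzi
    · apply h2 z
      simp only [Fin.le_def] at hz hzi ⊢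
      omega
  have hInot : ∀ i < n, ¬ I i →
      colorAt (move (SimpleGraph.pathGraph n) ω m) i = colorAt ω i := by
    intro i hi h
    rw [colorAt_of_lt _ hi, colorAt_of_lt _ hi, move, if_neg fun h' => h ⟨hi, h'⟩]
  have h : NonCrossing (colorAt ω) (fun i => if I i then 0 else g i + 1) 0 n := by
    constructor
    · intro i j h1 h2 h3 h4 h
      by_cases hi : I i <;> by_cases hj : I j <;> simp [hi, hj] at h
      · rw [hIcolor i hi, hIcolor j hj]
      · rw [← hInot i h2 hi, ← hInot j h4 hj]
        exact hg.color i j h1 h2 h3 h4 h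
    · intro i j k m h1 h2 h3 h4 h5 h6 h7
      by_cases hi : I i <;> by_cases hj : I j <;> by_cases hk : I k <;> by_cases hm : I m <;>
        simp [hi, hj, hk, hm] at h6 h7 ⊢
      · exact hj (hIconv i j k h2 h3 hi hk)
      · exact hk (hIconv j k m h3 h4 hj hm)
      · exact hg.cross i j k m h1 h2 h3 h4 h5 h6 h7
  refine h.minBlocks_le.trans ?_
  rw [← hb, blocks, blocks]
  have hsub : (Finset.Ico 0 n).image (fun i => if I i then 0 else g i + 1) ⊆
      insert 0 (((Finset.Ico 0 n).image g).image (· + 1)) := by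
    intro x hx
    simp only [Finset.mem_image, Finset.mem_insert] at hx ⊢
    obtain ⟨i, hi, rfl⟩ := hx
    by_cases hI : I i
    · simp [hI]
    · exact Or.inr ⟨g i, ⟨i, hi, rfl⟩, by simp [hI]⟩
  exact (Finset.card_le_card hsub).trans ((Finset.card_insert_le _ _).trans
    (Nat.succ_le_succ Finset.card_image_le))

theorem minBlocks_le_of_monochromatic {n c : ℕ} (ω : Fin n → Fin c) (h : Monochromatic ω) :
    minBlocks (colorAt ω) 0 n ≤ 1 := by
  obtain ⟨d, hd⟩ := h
  have h : NonCrossing (colorAt ω) (fun _ => 0) 0 n :=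
    ⟨fun i j _ hi _ hj _ => by rw [colorAt_of_lt ω hi, colorAt_of_lt ω hj, hd, hd],
      fun _ _ _ _ _ _ _ _ _ _ _ => rfl⟩
  refine h.minBlocks_le.trans (Finset.card_le_one.2 ?_)
  simp +contextual

theorem minBlocks_le_length {n c : ℕ} (S : List (Fin n × Fin c)) (ω : Fin n → Fin c)
    (h : Monochromatic (play (SimpleGraph.pathGraph n) ω S)) :
    minBlocks (colorAt ω) 0 n ≤ S.length + 1 := by
  induction S generalizing ω with
  | nil => exact minBlocks_le_of_monochromatic ω h
  | cons m S ih =>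
    exact (minBlocks_le_move ω m).trans (Nat.succ_le_succ (ih _ h))

/-- Induction on `b`: each round merges an interval block with a neighbour, by a move or for free.
-/
theorem NonCrossing.exists_play {n c : ℕ} (hn : 0 < n) (b : ℕ) (ω : Fin n → Fin c) (g : ℕ → ℕ)
    (hg : NonCrossing (colorAt ω) g 0 n) (hb : blocks g 0 n ≤ b + 1) :
    ∃ S : List (Fin n × Fin c), S.length ≤ b ∧
      Monochromatic (play (SimpleGraph.pathGraph n) ω S) := by
  classical
  induction b generalizing ω g with
  | zero =>
    refine ⟨[], le_rfl, ω ⟨0, hn⟩, fun v => ?_⟩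
    have hgv : g v = g 0 := Finset.card_le_one.1 hb _
      (Finset.mem_image_of_mem g (by simp)) _ (Finset.mem_image_of_mem g (by simpa using hn))
    have := hg.color v 0 (Nat.zero_le _) v.2 le_rfl hn hgv
    rw [colorAt_of_lt ω v.2, colorAt_of_lt ω hn] at this
    exact Fin.ext this
  | succ b ih =>
    obtain ⟨z, hz, hconv⟩ := hg.exists_convex hn
    by_cases hall : ∀ y < n, g y = g z
    · refine (ih ω g hg ?_).imp fun S hS => ⟨hS.1.trans (Nat.le_succ b), hS.2⟩
      refine (Finset.card_le_one.2 ?_).trans (Nat.le_add_left 1 b)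
      simp only [Finset.mem_image, Finset.mem_Ico]
      rintro _ ⟨i, hi, rfl⟩ _ ⟨j, hj, rfl⟩
      rw [hall i hi.2, hall j hj.2]
    push Not at hall
    obtain ⟨y, hy, hgy⟩ := hall
    -- If the colours agree across a border of the block, the blocks merge without a move.
    by_cases hex : ∃ u u', (u' = u + 1 ∨ u = u' + 1) ∧ g u = g z ∧ g u' ≠ g z ∧ u < n ∧ u' < n ∧
        colorAt ω u = colorAt ω u'
    · obtain ⟨u, u', hadj, hgu, hgu', hu, hu', hcol⟩ := hex
      obtain ⟨g', hg', hb'⟩ := hg.merge (a' := colorAt ω) hz hconv hadj hu hu' hgu hgu' (by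
        intro i hi
        split_ifs with h
        · rw [← hcol]
          exact hg.color i u (Nat.zero_le _) hi (Nat.zero_le _) hu (h.trans hgu.symm)
        · rfl)
      exact (ih ω g' hg' (by omega)).imp fun S hS => ⟨hS.1.trans (Nat.le_succ b), hS.2⟩
    · obtain ⟨u, u', hadj, hgu, hgu', h1, h2, h3, h4⟩ :=
        exists_adjacent_change (fun i => g i = g z) (x := z) (y := y) rfl hgy
      have hu : u < n := by omega
      have hu' : u' < n := by omega
      -- Otherwise both borders change colour, so the block is exactly a monochromatic component,
      -- and giving it the colour of `u'` recolours nothing else.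
      have hlink : ∀ i (hi : i < n),
          Linked (SimpleGraph.pathGraph n) ω ⟨u, hu⟩ ⟨i, hi⟩ ↔ g i = g z := by
        intro i hi
        rw [linked_pathGraph_iff]
        constructor
        · intro h
          by_contra hgi
          obtain ⟨v, v', hadj', hgv, hgv', h5, h6, h7, h8⟩ :=
            exists_adjacent_change (fun i => g i = g z) (x := u) (y := i) hgu hgi
          have hv : v < n := by omega
          have hv' : v' < n := by omega
          refine hex ⟨v, v', hadj', hgv, hgv', hv, hv', ?_⟩
          rw [colorAt_of_lt ω hv, colorAt_of_lt ω hv', h ⟨v, hv⟩, h ⟨v', hv'⟩] <;>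
          · simp only [Fin.mk_le_mk]
            omega
        · intro hgi w hw
          have hgw : g w = g z := by
            simp only [Fin.le_def] at hw
            by_cases hwu : (w : ℕ) = u
            · rw [hwu, hgu]
            by_cases hwi : (w : ℕ) = i
            · rw [hwi, hgi]
            rcases hw with hw | hw
            · exact hconv u w i (by omega) (by omega) hi hgu hgi
            · exact hconv i w u (by omega) (by omega) hu hgi hgu
          have := hg.color w u (Nat.zero_le _) w.2 (Nat.zero_le _) hu (hgw.trans hgu.symm)
          rw [colorAt_of_lt ω w.2, colorAt_of_lt ω hu] at this
          exact Fin.ext this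
      obtain ⟨g', hg', hb'⟩ := hg.merge
        (a' := colorAt (move (SimpleGraph.pathGraph n) ω (⟨u, hu⟩, ω ⟨u', hu'⟩)))
        hz hconv hadj hu hu' hgu hgu' (by
          intro i hi
          rw [colorAt_of_lt _ hi, colorAt_of_lt _ hi, colorAt_of_lt _ hu', move]
          simp only [hlink]
          split_ifs <;> rfl)
      obtain ⟨S, hS, hmono⟩ := ih _ g' hg' (by omega)
      exact ⟨(⟨u, hu⟩, ω ⟨u', hu'⟩) :: S, Nat.succ_le_succ hS, hmono⟩

theorem isFloodNumber_pathGraph {n c : ℕ} (hn : 0 < n) (ω : Fin n → Fin c) :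
    IsFloodNumber (SimpleGraph.pathGraph n) ω (minBlocks (colorAt ω) 0 n - 1) := by
  constructor
  · obtain ⟨g, hg, hb⟩ := exists_blocks_eq_minBlocks (colorAt ω) 0 n
    obtain ⟨S, hS, hmono⟩ := hg.exists_play hn (minBlocks (colorAt ω) 0 n - 1) ω g (by omega)
    have := minBlocks_le_length S ω hmono
    exact ⟨S, by omega, hmono⟩
  · rintro _ ⟨S, rfl, hS⟩
    have := minBlocks_le_length S ω hS
    omega

end FloodIt

/-! ### Rules for reasoning about programs and their running time. -/

namespace RAM

/-- The program `p` started in `m` halts within `T` steps in a memory that satisfies `Q`. -/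
def Runs (W : ℕ) (p : Prog) (m : Mem) (T : ℕ) (Q : Mem → Prop) : Prop :=
  ∃ m' t, Exec W p m m' t ∧ t ≤ T ∧ Q m'

theorem Runs.mono {W : ℕ} {p : Prog} {m : Mem} {T T' : ℕ} {Q Q' : Mem → Prop}
    (h : Runs W p m T Q) (hT : T ≤ T') (hQ : ∀ m', Q m' → Q' m') : Runs W p m T' Q' := by
  obtain ⟨m', t, h1, h2, h3⟩ := h
  exact ⟨m', t, h1, h2.trans hT, hQ m' h3⟩

theorem Runs.of_le {W : ℕ} {p : Prog} {m : Mem} {T T' : ℕ} {Q : Mem → Prop}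
    (h : Runs W p m T Q) (hT : T ≤ T') : Runs W p m T' Q :=
  h.mono hT fun _ => id

theorem Runs.skip {W : ℕ} {m : Mem} {Q : Mem → Prop} (h : Q m) : Runs W .skip m 1 Q :=
  ⟨m, 1, .skip m, le_rfl, h⟩

theorem Runs.store {W : ℕ} {a e : Expr} {m : Mem} {Q : Mem → Prop} (ha : a.Fits W m)
    (he : e.Fits W m) (h : Q (Function.update m (a.val m) (e.val m))) :
    Runs W (.store a e) m (a.cost + e.cost + 1) Q :=
  ⟨_, _, .store a e m ha he, le_rfl, h⟩

theorem Runs.seq {W : ℕ} {p q : Prog} {m : Mem} {s t : ℕ} {Q R : Mem → Prop}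
    (hp : Runs W p m s Q) (hq : ∀ m', Q m' → Runs W q m' t R) : Runs W (.seq p q) m (s + t) R := by
  obtain ⟨m₁, t₁, h1, h2, h3⟩ := hp
  obtain ⟨m₂, t₂, h4, h5, h6⟩ := hq m₁ h3
  exact ⟨m₂, _, .seq h1 h4, Nat.add_le_add h2 h5, h6⟩

theorem Runs.ite {W : ℕ} {b : Expr} {p q : Prog} {m : Mem} {T : ℕ} {Q : Mem → Prop}
    (hb : b.Fits W m) (hp : b.val m ≠ 0 → Runs W p m T Q) (hq : b.val m = 0 → Runs W q m T Q) :
    Runs W (.ite b p q) m (b.cost + 1 + T) Q := by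
  by_cases h : b.val m = 0
  · obtain ⟨m', t, h1, h2, h3⟩ := hq h
    exact ⟨m', _, .iteFalse hb h h1, Nat.add_le_add_left h2 _, h3⟩
  · obtain ⟨m', t, h1, h2, h3⟩ := hp h
    exact ⟨m', _, .iteTrue hb h h1, Nat.add_le_add_left h2 _, h3⟩

/-- A loop with an invariant `I k` that holds when `k` iterations are still to come. -/
theorem Runs.loop {W : ℕ} {b : Expr} {p : Prog} {T : ℕ} (I : ℕ → Mem → Prop)
    (hb : ∀ k m, I k m → b.Fits W m ∧ (b.val m = 0 ↔ k = 0))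
    (hp : ∀ k m, I (k + 1) m → Runs W p m T (I k)) (k : ℕ) (m : Mem) (h : I k m) :
    Runs W (.loop b p) m (k * (b.cost + 1 + T) + (b.cost + 1)) (I 0) := by
  induction k generalizing m with
  | zero =>
    obtain ⟨h1, h2⟩ := hb 0 m h
    exact ⟨m, _, .loopDone h1 (h2.2 rfl), by omega, h⟩
  | succ k ih =>
    obtain ⟨h1, h2⟩ := hb _ m h
    obtain ⟨m₁, t₁, h3, h4, h5⟩ := hp k m h
    obtain ⟨m₂, t₂, h6, h7, h8⟩ := ih m₁ h5
    refine ⟨m₂, _, .loopStep h1 (fun h => by simpa using h2.1 h) h3 h6, ?_, h8⟩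
    rw [Nat.succ_mul]
    omega

/-- The address of the `i`-th cell after the cell whose address is stored in cell `0`. -/
def varAddr (i : ℕ) : Expr := .add (.load (.const 0)) (.const i)

/-- The content of the cell `varAddr i`. -/
def var (i : ℕ) : Expr := .load (varAddr i)

/-- The address of the entry `(x, y)` of a table with `n + 1` columns that starts in cell `n + 6`,
where `n` is the content of cell `0`. -/
def cellAddr (x y : Expr) : Expr :=
  .add (varAddr 6) (.add (.mul x (.add (.load (.const 0)) (.const 1))) y)

/-- The entry `(x, y)` of the table. -/
def cell (x y : Expr) : Expr := .load (cellAddr x y)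

section
variable {W n i : ℕ} {m : Mem} {x y e : Expr} {t : ℕ} {p q : Prog} {Q : Mem → Prop}

theorem varAddr_val (h0 : m 0 = n) : (varAddr i).val m = n + i := by
  simp [varAddr, Expr.val, h0]

theorem varAddr_fits (h0 : m 0 = n) (hi : n + i < W) : (varAddr i).Fits W m := by
  simp only [varAddr, Expr.Fits, Expr.val, h0]
  omega

theorem var_val (h0 : m 0 = n) : (var i).val m = m (n + i) := by
  rw [var, Expr.val, varAddr_val h0]

theorem var_fits (h0 : m 0 = n) (hi : n + i < W) (hv : m (n + i) < W) : (var i).Fits W m :=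
  ⟨varAddr_fits h0 hi, by rwa [varAddr_val h0]⟩

theorem cellAddr_val (h0 : m 0 = n) :
    (cellAddr x y).val m = n + 6 + (x.val m * (n + 1) + y.val m) := by
  simp only [cellAddr, Expr.val, varAddr_val h0, h0]

theorem cell_val (h0 : m 0 = n) : (cell x y).val m = m (n + 6 + (x.val m * (n + 1) + y.val m)) := by
  rw [cell, Expr.val, cellAddr_val h0]

/-- The largest address is `n + 6 + (n * (n + 1) + n) = (n + 1) * (n + 1) + n + 5`, which explains
the shape of `hW`. -/
theorem cellAddr_fits (h0 : m 0 = n) (hW : (n + 1) * (n + 1) + n + 20 ≤ W) (hx : x.Fits W m)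
    (hy : y.Fits W m) (hxn : x.val m ≤ n) (hyn : y.val m ≤ n) : (cellAddr x y).Fits W m := by
  have h := Nat.mul_le_mul_right (n + 1) hxn
  rw [Nat.succ_mul] at hW
  simp only [cellAddr, Expr.Fits, Expr.val, h0, varAddr_val h0]
  refine ⟨varAddr_fits h0 ?_, ⟨⟨hx, ?_, ?_⟩, hy, ?_⟩, ?_⟩ <;> omega

theorem cell_fits (h0 : m 0 = n) (hW : (n + 1) * (n + 1) + n + 20 ≤ W) (hx : x.Fits W m)
    (hy : y.Fits W m) (hxn : x.val m ≤ n) (hyn : y.val m ≤ n)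
    (hv : (cell x y).val m < W) : (cell x y).Fits W m :=
  ⟨cellAddr_fits h0 hW hx hy hxn hyn, hv⟩

/-- The `5` is four steps for the address and one for the assignment. -/
theorem Runs.setVar (h0 : m 0 = n) (hi : n + i < W) (he : e.Fits W m)
    (h : Q (Function.update m (n + i) (e.val m))) :
    Runs W (.store (varAddr i) e) m (e.cost + 5) Q := by
  refine (Runs.store (varAddr_fits h0 hi) he ?_).mono (by simp only [varAddr, Expr.cost]; omega)
    fun _ => id
  rwa [varAddr_val h0]

theorem Runs.setVar_seq (h0 : m 0 = n) (hi : n + i < W) (he : e.Fits W m)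
    (h : Runs W q (Function.update m (n + i) (e.val m)) t Q) :
    Runs W (.seq (.store (varAddr i) e) q) m (e.cost + 5 + t) Q :=
  (Runs.setVar (Q := fun m' => m' = _) h0 hi he rfl).seq fun _ h' => h' ▸ h

end

end RAM

/-! ### The dynamic program and its memory layout. -/

namespace FloodIt

open RAM

/-- The cells that `pathProg` uses: the size, the colours, four variables and a table. -/
structure PathState (n : ℕ) (a : ℕ → ℕ) (l r j b : ℕ) (τ : ℕ → ℕ) (m : Mem) : Prop where
  size : m 0 = n
  color : ∀ i < n, m (i + 2) = a i
  left : m (n + 2) = l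
  right : m (n + 3) = r
  mid : m (n + 4) = j
  best : m (n + 5) = b
  table : ∀ x, m (n + 6 + x) = τ x

section
variable {n : ℕ} {a : ℕ → ℕ} {l r j b : ℕ} {τ : ℕ → ℕ} {m : Mem}

theorem PathState.setLeft (h : PathState n a l r j b τ m) (v : ℕ) :
    PathState n a v r j b τ (Function.update m (n + 2) v) := by
  obtain ⟨h0, h1, h2, h3, h4, h5, h6⟩ := h
  constructor <;> intros <;> simp only [Function.update_apply] <;> grind

theorem PathState.setRight (h : PathState n a l r j b τ m) (v : ℕ) :
    PathState n a l v j b τ (Function.update m (n + 3) v) := by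
  obtain ⟨h0, h1, h2, h3, h4, h5, h6⟩ := h
  constructor <;> intros <;> simp only [Function.update_apply] <;> grind

theorem PathState.setMid (h : PathState n a l r j b τ m) (v : ℕ) :
    PathState n a l r v b τ (Function.update m (n + 4) v) := by
  obtain ⟨h0, h1, h2, h3, h4, h5, h6⟩ := h
  constructor <;> intros <;> simp only [Function.update_apply] <;> grind

theorem PathState.setBest (h : PathState n a l r j b τ m) (v : ℕ) :
    PathState n a l r j v τ (Function.update m (n + 5) v) := by
  obtain ⟨h0, h1, h2, h3, h4, h5, h6⟩ := h
  constructor <;> intros <;> simp only [Function.update_apply] <;> grind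

theorem PathState.setTable (h : PathState n a l r j b τ m) (x v : ℕ) :
    PathState n a l r j b (Function.update τ x v) (Function.update m (n + 6 + x) v) := by
  obtain ⟨h0, h1, h2, h3, h4, h5, h6⟩ := h
  constructor <;> intros <;> simp only [Function.update_apply] <;> grind

end

/-- The table `τ` holds `minBlocks` for all intervals that start after `l`, and for those that start
at `l` and end at most at `r`. -/
def Filled (n : ℕ) (a : ℕ → ℕ) (l r : ℕ) (τ : ℕ → ℕ) : Prop :=
  ∀ x y, x ≤ y → y ≤ n → l < x ∨ l = x ∧ y ≤ r → τ (x * (n + 1) + y) = minBlocks a x y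

/-- Uniqueness of division by `n + 1` with remainder at most `n`. -/
theorem cell_index_inj {n x y x' y' : ℕ} (hy : y ≤ n) (hy' : y' ≤ n)
    (h : x * (n + 1) + y = x' * (n + 1) + y') : x = x' ∧ y = y' := by
  have key : ∀ {u v}, u < v → u * (n + 1) + (n + 1) ≤ v * (n + 1) := by
    intro u v huv
    rw [← Nat.succ_mul]
    exact Nat.mul_le_mul_right _ huv
  rcases lt_trichotomy x x' with hx | rfl | hx
  · have := key hx
    omega
  · omega
  · have := key hx
    omega

/-- Covers both ways the table grows: `r` advances by one, or a new row `l` starts with its empty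
interval. -/
theorem Filled.update {n : ℕ} {a : ℕ → ℕ} {l r l' r' : ℕ} {τ : ℕ → ℕ} (h : Filled n a l r τ)
    (hr : r' ≤ n) (hnew : ∀ x y, x ≤ y → y ≤ n → l' < x ∨ l' = x ∧ y ≤ r' →
      (l < x ∨ l = x ∧ y ≤ r) ∨ (x = l' ∧ y = r')) :
    Filled n a l' r' (Function.update τ (l' * (n + 1) + r') (minBlocks a l' r')) := by
  intro x y hxy hy hxy'
  by_cases he : x = l' ∧ y = r'
  · rw [he.1, he.2, Function.update_self]
  · rw [Function.update_of_ne fun h => he (cell_index_inj hy hr h)]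
    exact h x y hxy hy ((hnew x y hxy hy hxy').resolve_right he)

/-- The colour of the vertex `x`. -/
def colorExpr (x : Expr) : Expr := .load (.add x (.const 2))

/-- The table entry for the interval that starts after `l`. -/
def restCell (y : Expr) : Expr := cell (.add (var 2) (.const 1)) y

/-- The number of blocks if the next vertex of the block of `l` is `j`. -/
def splitExpr : Expr := .add (restCell (var 4)) (cell (var 4) (var 3))

/-- The body of the loop over `j`. -/
def midBody : Prog :=
  .seq
    -- The sum of the two truncated differences vanishes exactly when the colours agree, so `skip`
    -- is the branch for different colours.
    (.ite (.add (.sub (colorExpr (var 4)) (colorExpr (var 2)))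
        (.sub (colorExpr (var 2)) (colorExpr (var 4))))
      .skip
      (.ite (.sub (var 5) splitExpr) (.store (varAddr 5) splitExpr) .skip))
    (.store (varAddr 4) (.add (var 4) (.const 1)))

/-- The body of the loop over `r`. -/
def rightBody : Prog :=
  .seq (.store (varAddr 3) (.add (var 3) (.const 1)))
  (.seq (.store (varAddr 5) (.add (restCell (var 3)) (.const 1)))
  (.seq (.store (varAddr 4) (.add (var 2) (.const 1)))
  (.seq (.loop (.sub (var 3) (var 4)) midBody)
    (.store (cellAddr (var 2) (var 3)) (var 5)))))

/-- The body of the loop over `l`. -/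
def leftBody : Prog :=
  .seq (.store (varAddr 2) (.sub (var 2) (.const 1)))
  (.seq (.store (varAddr 3) (var 2))
  (.seq (.store (cellAddr (var 2) (var 3)) (.const 0))
    (.loop (.sub (.load (.const 0)) (var 3)) rightBody)))

/-- Fills a table with `minBlocks a l r` for all `l ≤ r ≤ n` by dynamic programming. -/
def pathProg : Prog :=
  .seq (.store (varAddr 2) (.load (.const 0)))
  (.seq (.loop (var 2) leftBody)
    -- All addresses depend on `n` in cell `0`, so that cell may be overwritten only at the very
    -- end.
    (.store (.const 0) (.sub (cell (.const 0) (.load (.const 0))) (.const 1))))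

/-! ### Correctness and running time of the loops. -/

section
variable {W n c : ℕ} {a : ℕ → ℕ} {l r j b : ℕ} {τ : ℕ → ℕ} {m : Mem}

theorem PathState.left_val (h : PathState n a l r j b τ m) : (var 2).val m = l := by
  rw [var_val h.size, h.left]

theorem PathState.right_val (h : PathState n a l r j b τ m) : (var 3).val m = r := by
  rw [var_val h.size, h.right]

theorem PathState.mid_val (h : PathState n a l r j b τ m) : (var 4).val m = j := by
  rw [var_val h.size, h.mid]

theorem PathState.best_val (h : PathState n a l r j b τ m) : (var 5).val m = b := by
  rw [var_val h.size, h.best]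

theorem PathState.left_fits (h : PathState n a l r j b τ m)
    (hW : (n + 1) * (n + 1) + n + c + 20 ≤ W) (hl : l ≤ n) : (var 2).Fits W m :=
  var_fits h.size (by omega) (by rw [h.left]; omega)

theorem PathState.right_fits (h : PathState n a l r j b τ m)
    (hW : (n + 1) * (n + 1) + n + c + 20 ≤ W) (hr : r ≤ n) : (var 3).Fits W m :=
  var_fits h.size (by omega) (by rw [h.right]; omega)

theorem PathState.mid_fits (h : PathState n a l r j b τ m)
    (hW : (n + 1) * (n + 1) + n + c + 20 ≤ W) (hj : j ≤ n) : (var 4).Fits W m :=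
  var_fits h.size (by omega) (by rw [h.mid]; omega)

theorem PathState.best_fits (h : PathState n a l r j b τ m)
    (hW : (n + 1) * (n + 1) + n + c + 20 ≤ W) (hb : b ≤ n + 1) : (var 5).Fits W m :=
  var_fits h.size (by omega) (by rw [h.best]; omega)

theorem PathState.cell_val {l' r' : ℕ} (h : PathState n a l' r' j b τ m) (hτ : Filled n a l r τ)
    {e f : Expr}
    (hef : e.val m ≤ f.val m) (hf : f.val m ≤ n)
    (hlr : l < e.val m ∨ l = e.val m ∧ f.val m ≤ r) :
    (cell e f).val m = minBlocks a (e.val m) (f.val m) := by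
  rw [RAM.cell_val h.size, h.table, hτ _ _ hef hf hlr]

theorem PathState.cell_fits {l' r' : ℕ} (h : PathState n a l' r' j b τ m) (hτ : Filled n a l r τ)
    (hW : (n + 1) * (n + 1) + n + c + 20 ≤ W) {e f : Expr} (he : e.Fits W m) (hf : f.Fits W m)
    (hef : e.val m ≤ f.val m) (hfn : f.val m ≤ n)
    (hlr : l < e.val m ∨ l = e.val m ∧ f.val m ≤ r) : (cell e f).Fits W m := by
  refine RAM.cell_fits h.size (by omega) he hf (hef.trans hfn) hfn ?_
  rw [h.cell_val hτ hef hfn hlr]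
  have := minBlocks_le_sub a (e.val m) (f.val m)
  omega

theorem PathState.restCell_val {r' : ℕ} (h : PathState n a l r' j b τ m) (hτ : Filled n a l r τ)
    {f : Expr} (hlf : l < f.val m) (hfn : f.val m ≤ n) :
    (restCell f).val m = minBlocks a (l + 1) (f.val m) := by
  have hv : (Expr.add (var 2) (.const 1)).val m = l + 1 := by
    simp only [Expr.val, h.left_val]
  rw [restCell, h.cell_val hτ (by omega) hfn (by omega), hv]

theorem PathState.restCell_fits {r' : ℕ} (h : PathState n a l r' j b τ m) (hτ : Filled n a l r τ)
    (hW : (n + 1) * (n + 1) + n + c + 20 ≤ W) {f : Expr} (hf : f.Fits W m)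
    (hlf : l < f.val m) (hfn : f.val m ≤ n) : (restCell f).Fits W m := by
  have hv : (Expr.add (var 2) (.const 1)).val m = l + 1 := by
    simp only [Expr.val, h.left_val]
  refine h.cell_fits hτ hW ⟨h.left_fits hW (by omega), ?_, ?_⟩ hf (by omega) hfn (by omega)
  · simp only [Expr.Fits]; omega
  · rw [h.left_val]; simp only [Expr.val]; omega

theorem PathState.colorExpr_val (h : PathState n a l r j b τ m) {e : Expr} (he : e.val m < n) :
    (colorExpr e).val m = a (e.val m) :=
  h.color _ he

theorem PathState.colorExpr_fits (h : PathState n a l r j b τ m)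
    (hW : (n + 1) * (n + 1) + n + c + 20 ≤ W) (ha : ∀ i < n, a i ≤ c) {e : Expr}
    (hf : e.Fits W m) (he : e.val m < n) : (colorExpr e).Fits W m := by
  refine ⟨⟨hf, ?_, ?_⟩, ?_⟩
  · simp only [Expr.Fits]; omega
  · simp only [Expr.val]; omega
  · have := ha _ he
    have := h.color _ he
    simp only [Expr.val]; omega

/-- The invariant of the loop over `j`, with `k` iterations to come. -/
def MidInv (n : ℕ) (a : ℕ → ℕ) (l r : ℕ) (τ : ℕ → ℕ) (k : ℕ) (m : Mem) : Prop :=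
  ∃ j b, l < j ∧ j + k = r + 1 ∧ PathState n a l (r + 1) j b τ m ∧ minBlocks a l (r + 1) ≤ b ∧
    b ≤ minBlocks a (l + 1) (r + 1) + 1 ∧
    ∀ j', l < j' → j' < j → a j' = a l → b ≤ minBlocks a (l + 1) j' + minBlocks a j' (r + 1)

/-- The two entries read belong to intervals starting at `l + 1` and at `j > l`, so `Filled n a l r`
already supplies them. -/
theorem MidInv.runs_midBody (hW : (n + 1) * (n + 1) + n + c + 20 ≤ W) (ha : ∀ i < n, a i ≤ c)
    (hr : r < n) (hτ : Filled n a l r τ) (k : ℕ) (m : Mem)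
    (h : MidInv n a l r τ (k + 1) m) : Runs W midBody m 200 (MidInv n a l r τ k) := by
  obtain ⟨j, b, hlj, hjk, hm, hb1, hb2, hb3⟩ := h
  have hfl := hm.left_fits hW (by omega)
  have hfr := hm.right_fits hW (by omega)
  have hfj := hm.mid_fits hW (by omega)
  have hB := minBlocks_le_sub a (l + 1) (r + 1)
  have hB1 := minBlocks_le_sub a (l + 1) j
  have hB2 := minBlocks_le_sub a j (r + 1)
  have hfb := hm.best_fits hW (by omega)
  have hcj : (colorExpr (var 4)).val m = a j := by
    rw [hm.colorExpr_val (by rw [hm.mid_val]; omega), hm.mid_val]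
  have hcl : (colorExpr (var 2)).val m = a l := by
    rw [hm.colorExpr_val (by rw [hm.left_val]; omega), hm.left_val]
  have hfcj := hm.colorExpr_fits hW ha hfj (by rw [hm.mid_val]; omega)
  have hfcl := hm.colorExpr_fits hW ha hfl (by rw [hm.left_val]; omega)
  have hv1 : (restCell (var 4)).val m = minBlocks a (l + 1) j := by
    rw [hm.restCell_val hτ (by rw [hm.mid_val]; omega) (by rw [hm.mid_val]; omega), hm.mid_val]
  have hv2 : (cell (var 4) (var 3)).val m = minBlocks a j (r + 1) := by
    rw [hm.cell_val hτ, hm.mid_val, hm.right_val] <;> rw [hm.right_val] <;>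
      try rw [hm.mid_val]
    all_goals omega
  have hf1 : (restCell (var 4)).Fits W m :=
    hm.restCell_fits hτ hW hfj (by rw [hm.mid_val]; omega) (by rw [hm.mid_val]; omega)
  have hf2 : (cell (var 4) (var 3)).Fits W m := by
    apply hm.cell_fits hτ hW hfj hfr <;> rw [hm.right_val] <;> try rw [hm.mid_val]
    all_goals omega
  have hval : splitExpr.val m = minBlocks a (l + 1) j + minBlocks a j (r + 1) := by
    rw [splitExpr, Expr.val, hv1, hv2]
  have hfits : splitExpr.Fits W m := ⟨hf1, hf2, by rw [hv1, hv2]; omega⟩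
  have hacj := ha j (by omega)
  have hacl := ha l (by omega)
  have hnext : ∀ b' m', PathState n a l (r + 1) j b' τ m' → minBlocks a l (r + 1) ≤ b' → b' ≤ b →
      (a j = a l → b' ≤ minBlocks a (l + 1) j + minBlocks a j (r + 1)) →
      Runs W (.store (varAddr 4) (.add (var 4) (.const 1))) m' 12 (MidInv n a l r τ k) := by
    intro b' m' hm' h1 h2 h3
    refine Runs.setVar hm'.size (by omega)
      ⟨hm'.mid_fits hW (by omega), (by simp only [Expr.Fits]; omega), ?_⟩ ?_
    · rw [hm'.mid_val]; simp only [Expr.val]; omega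
    · simp only [Expr.val, hm'.mid_val]
      refine ⟨j + 1, b', by omega, by omega, hm'.setMid _, h1, by omega, ?_⟩
      intro j' h4 h5 h6
      rcases (Nat.lt_succ_iff.1 h5).eq_or_lt with rfl | h5
      · exact h3 h6
      · exact h2.trans (hb3 j' h4 h5 h6)
  refine Runs.seq (s := 188) (t := 12) (Q := fun m' => ∃ b', PathState n a l (r + 1) j b' τ m' ∧
    minBlocks a l (r + 1) ≤ b' ∧ b' ≤ b ∧
      (a j = a l → b' ≤ minBlocks a (l + 1) j + minBlocks a j (r + 1))) ?_
    fun m' ⟨b', h1, h2, h3, h4⟩ => hnext b' m' h1 h2 h3 h4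
  refine Runs.of_le (Runs.ite (T := 140) ⟨⟨hfcj, hfcl⟩, ⟨hfcl, hfcj⟩, ?_⟩ ?_ ?_) (by decide)
  · simp only [Expr.val, hcj, hcl]
    omega
  · simp only [Expr.val, hcj, hcl]
    intro hne
    exact (Runs.skip ⟨b, hm, hb1, le_rfl, fun h => by omega⟩).of_le (by norm_num)
  · simp only [Expr.val, hcj, hcl]
    intro heq
    have hajl : a j = a l := by omega
    refine Runs.of_le (Runs.ite (T := 80) ⟨hfb, hfits⟩ ?_ ?_) (by decide)
    · rw [Expr.val, hm.best_val, hval]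
      intro hlt
      refine Runs.of_le (Runs.setVar hm.size (by omega) hfits ?_) (by decide)
      rw [hval]
      exact ⟨_, hm.setBest _, minBlocks_le_add a hlj (by omega) hajl, by omega, fun _ => le_rfl⟩
    · rw [Expr.val, hm.best_val, hval]
      intro hlt
      exact (Runs.skip ⟨b, hm, hb1, le_rfl, fun h => by omega⟩).of_le (by norm_num)

theorem MidInv.runs_loop (hW : (n + 1) * (n + 1) + n + c + 20 ≤ W) (ha : ∀ i < n, a i ≤ c)
    (hlr : l ≤ r) (hr : r < n) (hτ : Filled n a l r τ)
    (h : MidInv n a l r τ (r - l) m) :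
    Runs W (.loop (.sub (var 3) (var 4)) midBody) m (220 * n) fun m' =>
      ∃ j, PathState n a l (r + 1) j (minBlocks a l (r + 1)) τ m' := by
  refine (Runs.loop (MidInv n a l r τ) ?_ (MidInv.runs_midBody hW ha hr hτ) _ m h).mono ?_ ?_
  · rintro k m ⟨j, b, hlj, hjk, hm, -⟩
    refine ⟨⟨hm.right_fits hW (by omega), hm.mid_fits hW (by omega)⟩, ?_⟩
    rw [Expr.val, hm.right_val, hm.mid_val]
    omega
  · simp only [Expr.cost, var, varAddr]
    omega
  · rintro m' ⟨j, b, hlj, hjk, hm, hb1, hb2, hb3⟩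
    -- On exit every `j` up to `r` has been tried, so `le_minBlocks` leaves no smaller value for the
    -- minimum.
    have hb : b ≤ minBlocks a l (r + 1) := by
      rcases le_minBlocks a (show l < r + 1 by omega) with h | ⟨j', h1, h2, h3, h4⟩
      · exact hb2.trans h
      · exact (hb3 j' h1 (by omega) h3).trans h4
    obtain rfl : b = minBlocks a l (r + 1) := hb.antisymm hb1
    exact ⟨j, hm⟩

/-- The invariant of the loop over `r`, with `k` iterations to come. -/
def RightInv (n : ℕ) (a : ℕ → ℕ) (l k : ℕ) (m : Mem) : Prop :=
  ∃ r j b τ, l ≤ r ∧ r + k = n ∧ PathState n a l r j b τ m ∧ Filled n a l r τ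

theorem Runs.setTable {T r' v : ℕ} (hW : (n + 1) * (n + 1) + n + c + 20 ≤ W)
    (hm : PathState n a l r' j b τ m) (hl : l ≤ n) (hr : r' ≤ n) {e : Expr} (he : e.Fits W m)
    (hv : e.val m = v) {Q : Mem → Prop} (hT : e.cost + 25 ≤ T)
    (hQ : PathState n a l r' j b (Function.update τ (l * (n + 1) + r') v)
      (Function.update m (n + 6 + (l * (n + 1) + r')) v) →
      Q (Function.update m (n + 6 + (l * (n + 1) + r')) v)) :
    Runs W (.store (cellAddr (var 2) (var 3)) e) m T Q := by
  refine Runs.of_le (Runs.store (cellAddr_fits hm.size (by omega) (hm.left_fits hW hl)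
    (hm.right_fits hW hr) (by rwa [hm.left_val]) (by rwa [hm.right_val])) he ?_)
      (le_trans ?_ hT)
  · rw [cellAddr_val hm.size, hm.left_val, hm.right_val, hv]
    exact hQ (hm.setTable _ _)
  · simp only [cellAddr, varAddr, var, Expr.cost]
    omega

theorem RightInv.runs_rightBody (hW : (n + 1) * (n + 1) + n + c + 20 ≤ W) (ha : ∀ i < n, a i ≤ c)
    (hl : l < n) (k : ℕ) (m : Mem) (h : RightInv n a l (k + 1) m) :
    Runs W rightBody m (220 * n + 200) (RightInv n a l k) := by
  obtain ⟨r, j, b, τ, hlr, hrk, hm, hτ⟩ := h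
  refine Runs.of_le (Runs.setVar_seq (t := 220 * n + 180) hm.size (by omega)
    ⟨hm.right_fits hW (by omega), by simp only [Expr.Fits]; omega, ?_⟩ ?_)
      (by simp only [Expr.cost, var, varAddr]; omega)
  · rw [hm.right_val]; simp only [Expr.val]; omega
  simp only [Expr.val, hm.right_val]
  have hm := hm.setRight (r + 1)
  -- The concrete memory is forgotten; `PathState` records all that matters. The later updates are
  -- treated alike.
  generalize Function.update m (n + 3) (r + 1) = m at hm
  have hB := minBlocks_le_sub a (l + 1) (r + 1)
  have hv : (restCell (var 3)).val m = minBlocks a (l + 1) (r + 1) := by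
    rw [hm.restCell_val hτ (by rw [hm.right_val]; omega) (by rw [hm.right_val]; omega),
      hm.right_val]
  refine Runs.of_le (Runs.setVar_seq (t := 220 * n + 100) hm.size (by omega)
    ⟨hm.restCell_fits hτ hW (hm.right_fits hW (by omega)) (by rw [hm.right_val]; omega)
      (by rw [hm.right_val]; omega), by simp only [Expr.Fits]; omega, ?_⟩ ?_)
      (by simp only [Expr.cost, restCell, cell, cellAddr, var, varAddr]; omega)
  · rw [hv]; simp only [Expr.val]; omega
  simp only [Expr.val, hv]
  have hm := hm.setBest (minBlocks a (l + 1) (r + 1) + 1)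
  generalize Function.update m (n + 5) (minBlocks a (l + 1) (r + 1) + 1) = m at hm
  refine Runs.of_le (Runs.setVar_seq (t := 220 * n + 80) hm.size (by omega)
    ⟨hm.left_fits hW (by omega), by simp only [Expr.Fits]; omega, ?_⟩ ?_)
      (by simp only [Expr.cost, var, varAddr]; omega)
  · rw [hm.left_val]; simp only [Expr.val]; omega
  simp only [Expr.val, hm.left_val]
  have hm := hm.setMid (l + 1)
  generalize Function.update m (n + 4) (l + 1) = m at hm
  -- Before any `j` is tried, the best value is that of the singleton block of `l`.
  have hinv : MidInv n a l r τ (r - l) m :=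
    ⟨l + 1, _, by omega, by omega, hm, minBlocks_le_succ a l (r + 1), le_rfl, by omega⟩
  refine (Runs.seq (MidInv.runs_loop hW ha hlr (by omega) hτ hinv) (t := 80) ?_)
  rintro m' ⟨j, hm'⟩
  have hB' := minBlocks_le_sub a l (r + 1)
  refine Runs.setTable hW hm' (by omega) (by omega) (hm'.best_fits hW (by omega)) hm'.best_val
    (by simp only [Expr.cost, var, varAddr]; omega) fun hm'' => ?_
  exact ⟨r + 1, _, _, _, by omega, by omega, hm'', hτ.update (by omega) (by omega)⟩

/-- The invariant of the loop over `l`, with `k` iterations to come. -/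
def LeftInv (n : ℕ) (a : ℕ → ℕ) (k : ℕ) (m : Mem) : Prop :=
  ∃ r j b τ, k ≤ n ∧ PathState n a k r j b τ m ∧ Filled n a k n τ

theorem LeftInv.runs_leftBody (hW : (n + 1) * (n + 1) + n + c + 20 ≤ W) (ha : ∀ i < n, a i ≤ c)
    (k : ℕ) (m : Mem) (h : LeftInv n a (k + 1) m) :
    Runs W leftBody m (n * (220 * n + 220) + 100) (LeftInv n a k) := by
  obtain ⟨r, j, b, τ, hk, hm, hτ⟩ := h
  refine Runs.of_le (Runs.setVar_seq (t := n * (220 * n + 220) + 80) hm.size (by omega)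
    ⟨hm.left_fits hW (by omega), by simp only [Expr.Fits]; omega⟩ ?_)
      (by simp only [Expr.cost, var, varAddr]; omega)
  simp only [Expr.val, hm.left_val, Nat.add_sub_cancel]
  have hm := hm.setLeft k
  generalize Function.update m (n + 2) k = m at hm
  refine Runs.of_le (Runs.setVar_seq (t := n * (220 * n + 220) + 60) hm.size (by omega)
    (hm.left_fits hW (by omega)) ?_)
      (by simp only [Expr.cost, var, varAddr]; omega)
  rw [hm.left_val]
  have hm := hm.setRight k
  generalize Function.update m (n + 3) k = m at hm
  refine Runs.of_le (Runs.seq (s := 30) (t := n * (220 * n + 220) + 10)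
    (Q := RightInv n a k (n - k)) ?_ ?_) (by omega)
  · refine Runs.setTable (v := 0) hW hm (by omega) (by omega) (by simp only [Expr.Fits]; omega) rfl
      (by simp only [Expr.cost]; omega) fun hm' => ?_
    refine ⟨k, _, _, _, le_rfl, by omega, hm', ?_⟩
    -- The stored `0` is the value for the empty interval.
    rw [← minBlocks_self a k]
    exact hτ.update (by omega) (by omega)
  · intro m' hm'
    refine (Runs.loop (RightInv n a k) ?_ (RightInv.runs_rightBody hW ha (by omega)) _ m' hm').mono
      ?_ ?_
    · rintro k' m ⟨r, j, b, τ, hkr, hrk, hm, -⟩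
      refine ⟨⟨⟨by simp only [Expr.Fits]; omega, ?_⟩, hm.right_fits hW (by omega)⟩, ?_⟩
      · simp only [Expr.val, hm.size]; omega
      · simp only [Expr.val, hm.size, hm.right_val]; omega
    · refine Nat.add_le_add (Nat.mul_le_mul (Nat.sub_le n k) ?_) ?_ <;>
      · simp only [Expr.cost, var, varAddr]
        omega
    · rintro m'' ⟨r, j, b, τ, hkr, hrk, hm, hτ⟩
      obtain rfl : r = n := hrk
      exact ⟨r, j, b, τ, by omega, hm, hτ⟩

theorem pathState_inputMem {n c : ℕ} (ω : Fin n → Fin c) :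
    PathState n (colorAt ω) 0 0 0 0 (fun _ => 0) (inputMem ω) := by
  have h0 : ∀ i, n ≤ i → inputMem ω (i + 2) = 0 := fun i hi => dif_neg (by omega)
  exact ⟨rfl, fun i _ => rfl, h0 n le_rfl, h0 (n + 1) (by omega), h0 (n + 2) (by omega),
    h0 (n + 3) (by omega), fun x => by
      rw [show n + 6 + x = n + 4 + x + 2 by omega]
      exact h0 _ (by omega)⟩

theorem runs_pathProg {n c : ℕ} (ω : Fin n → Fin c)
    (hW : (n + 1) * (n + 1) + n + c + 20 ≤ W) :
    Runs W pathProg (inputMem ω) (n * (n * (220 * n + 220) + 120) + 100)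
      fun m' => m' 0 = minBlocks (colorAt ω) 0 n - 1 := by
  have ha : ∀ i < n, colorAt ω i ≤ c := by
    intro i hi
    rw [colorAt_of_lt ω hi]
    exact (ω ⟨i, hi⟩).2.le
  have hm := pathState_inputMem ω
  generalize colorAt ω = a at *
  generalize inputMem ω = m at *
  have hsize : ∀ {l r j b τ m}, PathState n a l r j b τ m → (Expr.load (.const 0)).Fits W m := by
    intro l r j b τ m hm
    refine ⟨by simp only [Expr.Fits]; omega, ?_⟩
    simp only [Expr.val, hm.size]
    omega
  refine Runs.of_le (Runs.setVar_seq (t := n * (n * (220 * n + 220) + 120) + 80) hm.size (by omega)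
    (hsize hm) ?_) (by simp only [Expr.cost]; omega)
  simp only [Expr.val, hm.size]
  have hm := hm.setLeft n
  generalize Function.update m (n + 2) n = m at hm
  -- In row `n` only the empty interval matters, and the table is initially zero.
  have hinv : LeftInv n a n m := by
    refine ⟨_, _, _, _, le_rfl, hm, fun x y h1 h2 h3 => ?_⟩
    obtain rfl : x = y := by omega
    exact (minBlocks_self a x).symm
  refine Runs.of_le (Runs.seq (t := 60) (Runs.loop (LeftInv n a) ?_ (LeftInv.runs_leftBody hW ha)
    n m hinv) ?_) ?_
  · rintro k m ⟨r, j, b, τ, hk, hm, -⟩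
    exact ⟨hm.left_fits hW hk, by rw [hm.left_val]⟩
  · rintro m' ⟨r, j, b, τ, hk, hm, hτ⟩
    have hc : (Expr.const 0).Fits W m' := by simp only [Expr.Fits]; omega
    have hv0 : (Expr.const 0).val m' = 0 := rfl
    have hvn : (Expr.load (.const 0)).val m' = n := hm.size
    refine Runs.of_le (Runs.store hc ⟨hm.cell_fits hτ hW hc (hsize hm) ?_ ?_ ?_, ?_⟩ ?_)
      (by decide)
    · rw [hv0]; exact Nat.zero_le _
    · rw [hvn]
    · rw [hv0, hvn]; omega
    · simp only [Expr.Fits]; omega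
    · rw [hv0, Function.update_self, Expr.val, hm.cell_val hτ, hv0, hvn]
      · rfl
      · rw [hv0]; exact Nat.zero_le _
      · rw [hvn]
      · rw [hv0, hvn]; omega
  · have : (var 2).cost = 5 := rfl
    rw [this]
    rw [Nat.add_assoc]
    exact Nat.add_le_add (Nat.mul_le_mul_left n (by omega)) (by norm_num)

end

theorem solvesPathWithin_pathProg {n c : ℕ} (hn : 1 ≤ n) (ω : Fin n → Fin c) :
    SolvesPathWithin pathProg 4 (700 * n ^ 3) ω := by
  -- A vertex has a colour, so `n + c + 2` is at least `4` and its fourth power exceeds all words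
  -- needed.
  have hc : 1 ≤ c := (ω ⟨0, hn⟩).pos
  obtain ⟨m, t, h1, h2, h3⟩ := runs_pathProg (W := (n + c + 2) ^ 4) ω (by
    have h4 : 4 ≤ n + c + 2 := by omega
    have h5 : (n + c + 2) * (4 * 4) ≤ (n + c + 2) * ((n + c + 2) * (n + c + 2)) :=
      Nat.mul_le_mul_left _ (Nat.mul_le_mul h4 h4)
    nlinarith [Nat.mul_le_mul_left (n + c + 2) h5])
  refine ⟨m, t, h1, h2.trans ?_, h3 ▸ isFloodNumber_pathGraph hn ω⟩
  -- Bounding every power by `n ^ 3` gives the coefficient `220 + 220 + 120 + 100 = 660 ≤ 700`.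
  have h4 : n ^ 2 ≤ n ^ 3 := Nat.pow_le_pow_right hn (by omega)
  have h5 : n ≤ n ^ 3 := Nat.le_self_pow (by omega) n
  have h6 : 1 ≤ n ^ 3 := Nat.one_le_pow _ _ hn
  nlinarith

end FloodIt

theorem mainTheorem3 :
    -- the number of colours is part of the input: time `O(n ^ 6)`
    (∃ (p : RAM.Prog) (k K : ℕ), ∀ (n c : ℕ) (ω : Fin n → Fin c), 1 ≤ n →
      FloodIt.SolvesPathWithin p k (K * n ^ 6) ω) ∧
    -- the number `c` of colours is fixed: time `O(n ^ 4)`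
    (∀ c : ℕ, ∃ (p : RAM.Prog) (k K : ℕ), ∀ (n : ℕ) (ω : Fin n → Fin c), 1 ≤ n →
      FloodIt.SolvesPathWithin p k (K * n ^ 4) ω) ∧
    -- flooding a path is the same as linking its two end-vertices
    (∀ (n c : ℕ) (ω : Fin (n + 1) → Fin c),
      (∀ S : List (Fin (n + 1) × Fin c),
        FloodIt.Monochromatic (FloodIt.play (SimpleGraph.pathGraph (n + 1)) ω S) ↔
          FloodIt.Linked (SimpleGraph.pathGraph (n + 1))
            (FloodIt.play (SimpleGraph.pathGraph (n + 1)) ω S) 0 (Fin.last n)) ∧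
      ∀ r : ℕ, FloodIt.IsFloodNumber (SimpleGraph.pathGraph (n + 1)) ω r ↔
        FloodIt.IsLinkNumber (SimpleGraph.pathGraph (n + 1)) ω 0 (Fin.last n) r) := by
  -- The cubic bound implies both required bounds, with constants independent even of `c`.
  have key : ∀ (e n c : ℕ) (ω : Fin n → Fin c), 3 ≤ e → 1 ≤ n →
      FloodIt.SolvesPathWithin FloodIt.pathProg 4 (700 * n ^ e) ω := by
    intro e n c ω he hn
    obtain ⟨m, t, h1, h2, h3⟩ := FloodIt.solvesPathWithin_pathProg hn ω
    exact ⟨m, t, h1, h2.trans (Nat.mul_le_mul_left _ (Nat.pow_le_pow_right hn he)), h3⟩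
  refine ⟨⟨FloodIt.pathProg, 4, 700, fun n c ω => key 6 n c ω (by norm_num)⟩,
    fun c => ⟨FloodIt.pathProg, 4, 700, fun n ω => key 4 n c ω (by norm_num)⟩, fun n c ω =>
      ⟨fun S => FloodIt.monochromatic_iff_linked _, fun r => ?_⟩⟩
  -- The equivalence for each final colouring makes the two minimised sets identical.
  simp only [FloodIt.IsFloodNumber, FloodIt.IsLinkNumber, FloodIt.monochromatic_iff_linked]
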